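/- Let $X$ be a real or complex Hilbert space, let $M$ and $N$ be closed subspaces of $X$, and put $M_1=M\ominus(M\cap N)$ and $N_1=N\ominus(M\cap N)$ (orthogonal complements of $M\cap N$ in $M$ and in $N$). A closed subspace $K$ of $X$ is a common complement of $M$ and $N$ if $M\cap K=N\cap K=\{0\}$ and $M+K=N+K=X$ (algebraic sums). Two unordered pairs of closed subspaces of two Hilbert spaces are unitarily equivalent if a linear isometry of the first space onto the second takes the first pair to the second. For a bounded linear operator $T:X_1\to X_2$ between Hilbert spaces, $\mathrm{Gr}(T)=\{(x,Tx):x\in X_1\}$ is its graph in the Hilbert space direct sum $X_1\oplus X_2$. Then the following are equivalent: 1. $M^{\perp}$ is a common complement of $M$ and $N$ in $X$. 2. There exist Hilbert spaces $X_1,X_2$ and a bounded linear operator $T:X_1\to X_2$ with $I-T^*T$ injective and $I-TT^*$ onto such that $\{M,N\}$ is unitarily equivalent to $\{\mathrm{Gr}(-T),\mathrm{Gr}(T)\}$. 3. There exist Hilbert spaces $X_1,X_2$ and an injective bounded linear operator $T:X_1\to X_2$ with $I-T^*T$ injective and $I-TT^*$ onto such that the pair $\{M_1,N_1\}$ of subspaces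 of $X$ is unitarily equivalent to $\{\mathrm{Gr}(-T),\mathrm{Gr}(T)\}$. 4. There exist Hilbert spaces $Y_1,Y_2$ and a bounded linear operator $S:Y_1\to Y_2$ such that $\{M,N\}$ is unitarily equivalent to $\{Y_1\oplus\{0\},\mathrm{Gr}(S)\}$. Moreover, there is a representation of $\{M,N\}$ as in 2 with $T$ injective if and only if $M^{\perp}$ is a common complement of $M$ and $N$ and $M\cap N=\{0\}$. -/

import Mathlib

namespace CommonComplement

universe u v

/-- `K` is a common (algebraic) complement of `M` and `N`: `K` is closed,
`M ∩ K = N ∩ K = {0}` and `M + K = N + K = X` (algebraic sums). -/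
def IsCommonComplement {𝕜 : Type*} [RCLike 𝕜] {X : Type*} [NormedAddCommGroup X]
    [InnerProductSpace 𝕜 X] (K M N : Submodule 𝕜 X) : Prop :=
  IsClosed (K : Set X) ∧ IsCompl M K ∧ IsCompl N K

/-- The unordered pairs `{M, N}` and `{A, B}` of subspaces are unitarily equivalent: some
surjective linear isometry takes the one unordered pair to the other. -/
def UnitarilyEquivalentPairs {𝕜 : Type*} [RCLike 𝕜] {X Y : Type*}
    [NormedAddCommGroup X] [InnerProductSpace 𝕜 X]
    [NormedAddCommGroup Y] [InnerProductSpace 𝕜 Y]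
    (M N : Submodule 𝕜 X) (A B : Submodule 𝕜 Y) : Prop :=
  ∃ U : X ≃ₗᵢ[𝕜] Y,
    (M.map (U.toLinearEquiv : X →ₗ[𝕜] Y) = A ∧ N.map (U.toLinearEquiv : X →ₗ[𝕜] Y) = B) ∨
    (M.map (U.toLinearEquiv : X →ₗ[𝕜] Y) = B ∧ N.map (U.toLinearEquiv : X →ₗ[𝕜] Y) = A)

/-- The graph `Gr(T) = {(x, T x)}` as a subspace of the Hilbert space direct sum `X₁ ⊕ X₂`,
which is `WithLp 2 (X₁ × X₂)`. -/
def Gr {𝕜 : Type*} [RCLike 𝕜] {X₁ X₂ : Type*}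
    [NormedAddCommGroup X₁] [InnerProductSpace 𝕜 X₁]
    [NormedAddCommGroup X₂] [InnerProductSpace 𝕜 X₂]
    (T : X₁ →L[𝕜] X₂) : Submodule 𝕜 (WithLp 2 (X₁ × X₂)) :=
  (LinearMap.graph (T : X₁ →ₗ[𝕜] X₂)).comap
    (WithLp.linearEquiv 2 𝕜 (X₁ × X₂) : WithLp 2 (X₁ × X₂) →ₗ[𝕜] X₁ × X₂)

/-- The subspace `Y₁ ⊕ {0}` of the Hilbert space direct sum `Y₁ ⊕ Y₂`. -/
def firstSummand (𝕜 : Type*) [RCLike 𝕜] (Y₁ Y₂ : Type*)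
    [NormedAddCommGroup Y₁] [InnerProductSpace 𝕜 Y₁]
    [NormedAddCommGroup Y₂] [InnerProductSpace 𝕜 Y₂] :
    Submodule 𝕜 (WithLp 2 (Y₁ × Y₂)) :=
  ((⊤ : Submodule 𝕜 Y₁).prod (⊥ : Submodule 𝕜 Y₂)).comap
    (WithLp.linearEquiv 2 𝕜 (Y₁ × Y₂) : WithLp 2 (Y₁ × Y₂) →ₗ[𝕜] Y₁ × Y₂)

/-- `M ⊖ L`, the orthogonal complement of `L` in `M`. -/
def orthoDiff {𝕜 : Type*} [RCLike 𝕜] {X : Type*} [NormedAddCommGroup X]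
    [InnerProductSpace 𝕜 X] (M L : Submodule 𝕜 X) : Submodule 𝕜 X :=
  M ⊓ Lᗮ

/-- There are Hilbert spaces `X₁`, `X₂` and a bounded linear operator `T : X₁ → X₂` with
`I - T* T` injective and `I - T T*` onto such that `{M, N}` is unitarily equivalent to
`{Gr(-T), Gr(T)}`. -/
def HasSymmetricGraphModel {𝕜 : Type u} [RCLike 𝕜] {X : Type v} [NormedAddCommGroup X]
    [InnerProductSpace 𝕜 X] (M N : Submodule 𝕜 X) : Prop :=
  ∃ (X₁ X₂ : Type v)
    (_ : NormedAddCommGroup X₁) (_ : InnerProductSpace 𝕜 X₁) (_ : CompleteSpace X₁)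
    (_ : NormedAddCommGroup X₂) (_ : InnerProductSpace 𝕜 X₂) (_ : CompleteSpace X₂)
    (T : X₁ →L[𝕜] X₂),
    Function.Injective (ContinuousLinearMap.id 𝕜 X₁ - (ContinuousLinearMap.adjoint T).comp T) ∧
    Function.Surjective (ContinuousLinearMap.id 𝕜 X₂ - T.comp (ContinuousLinearMap.adjoint T)) ∧
    UnitarilyEquivalentPairs M N (Gr (-T)) (Gr T)

/-- The same, with `T` injective in addition. -/
def HasInjectiveSymmetricGraphModel {𝕜 : Type u} [RCLike 𝕜] {X : Type v}
    [NormedAddCommGroup X] [InnerProductSpace 𝕜 X] (M N : Submodule 𝕜 X) : Prop :=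
  ∃ (X₁ X₂ : Type v)
    (_ : NormedAddCommGroup X₁) (_ : InnerProductSpace 𝕜 X₁) (_ : CompleteSpace X₁)
    (_ : NormedAddCommGroup X₂) (_ : InnerProductSpace 𝕜 X₂) (_ : CompleteSpace X₂)
    (T : X₁ →L[𝕜] X₂),
    Function.Injective T ∧
    Function.Injective (ContinuousLinearMap.id 𝕜 X₁ - (ContinuousLinearMap.adjoint T).comp T) ∧
    Function.Surjective (ContinuousLinearMap.id 𝕜 X₂ - T.comp (ContinuousLinearMap.adjoint T)) ∧
    UnitarilyEquivalentPairs M N (Gr (-T)) (Gr T)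

/-- There are Hilbert spaces `Y₁`, `Y₂` and a bounded linear operator `S : Y₁ → Y₂` such that
`{M, N}` is unitarily equivalent to `{Y₁ ⊕ {0}, Gr(S)}`. -/
def HasOneSidedGraphModel {𝕜 : Type u} [RCLike 𝕜] {X : Type v} [NormedAddCommGroup X]
    [InnerProductSpace 𝕜 X] (M N : Submodule 𝕜 X) : Prop :=
  ∃ (Y₁ Y₂ : Type v)
    (_ : NormedAddCommGroup Y₁) (_ : InnerProductSpace 𝕜 Y₁) (_ : CompleteSpace Y₁)
    (_ : NormedAddCommGroup Y₂) (_ : InnerProductSpace 𝕜 Y₂) (_ : CompleteSpace Y₂)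
    (S : Y₁ →L[𝕜] Y₂),
    UnitarilyEquivalentPairs M N (firstSummand 𝕜 Y₁ Y₂) (Gr S)

end CommonComplement

/-! All the conditions come down to the single algebraic condition `N ⊕ Mᗮ = X`. It is symmetric in
`M` and `N`, by passing to the adjoint of the projection `N → M`, and splitting off a common
subspace of `M` and `N` does not affect it. For graphs it is a matter of solving linear equations:
`Gr(T) ⊕ Gr(-T)ᗮ` is the whole space exactly when `I - T* T` is injective and `I - T T*` is onto.

Conversely, let `u` and `v` be the reflections in `M` and `N`. Complementarity of `N` and `Mᗮ` is
the invertibility of `u + v`, and by the parallelogram law this forces `‖u - v‖ < 2`. Since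
`(u + v)² = 4 - (u - v)²` commutes with `u` and `v`, it has an invertible self-adjoint square root
`r` that commutes with them too, so that `w = (u + v) r⁻¹` is a symmetry with `w u = v w`. It is
the reflection in a subspace `L` bisecting `M` and `N`: as `(u + w)² = 2 + r` is invertible, `M` is
the graph of an operator `T : L → Lᗮ`, and `N`, the mirror image of `M` in `L`, is the graph of
`-T`. -/

namespace CommonComplement

open ContinuousLinearMap Function Metric Submodule
open scoped NNReal

section SquareRoot

variable (𝕜 : Type*) {A : Type*} [RCLike 𝕜] [NormedRing A] [NormedAlgebra 𝕜 A]

/-- Visser's iteration for the square root of `1 - b`: its fixed points are the `y` with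
`(1 - y)² = 1 - b`. -/
noncomputable def visserMap (b x : A) : A := (2⁻¹ : 𝕜) • (b + x * x)

variable {𝕜}

theorem one_sub_mul_one_sub_of_isFixedPt_visserMap {b y : A} (hy : IsFixedPt (visserMap 𝕜 b) y) :
    (1 - y) * (1 - y) = 1 - b := by
  have hdouble : b + y * y = y + y := by
    rw [← two_smul 𝕜 y, ← inv_smul_eq_iff₀ two_ne_zero]
    exact hy
  calc (1 - y) * (1 - y) = 1 - (y + y) + y * y := by noncomm_ring
    _ = 1 - b := by rw [← hdouble]; abel

theorem mapsTo_visserMap_closedBall {b : A} (hb : ‖b‖ ≤ 1) :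
    Set.MapsTo (visserMap 𝕜 b) (closedBall 0 ‖b‖) (closedBall 0 ‖b‖) := by
  simp only [Set.MapsTo, mem_closedBall_zero_iff]
  intro x hx
  calc ‖visserMap 𝕜 b x‖ = 2⁻¹ * ‖b + x * x‖ := by
        rw [visserMap, norm_smul, norm_inv, RCLike.norm_ofNat]
    _ ≤ 2⁻¹ * (‖b‖ + ‖x‖ * ‖x‖) := by
        gcongr
        exact (norm_add_le _ _).trans (by gcongr; exact norm_mul_le _ _)
    _ ≤ ‖b‖ := by nlinarith [norm_nonneg x]

theorem lipschitzOnWith_visserMap_closedBall (b : A) (r : ℝ≥0) :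
    LipschitzOnWith r (visserMap 𝕜 b) (closedBall 0 r) := by
  refine LipschitzOnWith.of_dist_le_mul fun x hx z hz ↦ ?_
  rw [mem_closedBall_zero_iff] at hx hz
  have hsub : visserMap 𝕜 b x - visserMap 𝕜 b z = (2⁻¹ : 𝕜) • (x * (x - z) + (x - z) * z) := by
    rw [visserMap, visserMap, ← smul_sub]
    congr 1
    noncomm_ring
  calc dist (visserMap 𝕜 b x) (visserMap 𝕜 b z)
      = 2⁻¹ * ‖x * (x - z) + (x - z) * z‖ := by
        rw [dist_eq_norm, hsub, norm_smul, norm_inv, RCLike.norm_ofNat]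
    _ ≤ 2⁻¹ * (r * ‖x - z‖ + ‖x - z‖ * r) := by
        gcongr
        exact (norm_add_le _ _).trans (add_le_add ((norm_mul_le _ _).trans (by gcongr))
          ((norm_mul_le _ _).trans (by gcongr)))
    _ = r * dist x z := by rw [dist_eq_norm]; ring

variable [CompleteSpace A]

theorem exists_mem_isFixedPt_visserMap {b : A} (hb : ‖b‖ < 1) {s : Set A} (hs : IsClosed s)
    (hzero : 0 ∈ s) (hmaps : Set.MapsTo (visserMap 𝕜 b) s s) :
    ∃ y ∈ s, ‖y‖ ≤ ‖b‖ ∧ IsFixedPt (visserMap 𝕜 b) y := by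
  have hball := hmaps.inter_inter (mapsTo_visserMap_closedBall (𝕜 := 𝕜) hb.le)
  have hcontracting : ContractingWith ‖b‖₊ (hball.restrict _ _ _) :=
    ⟨hb, ((lipschitzOnWith_visserMap_closedBall b ‖b‖₊).mono
      Set.inter_subset_right).mapsToRestrict hball⟩
  obtain ⟨y, hy, hfixed, -⟩ := hcontracting.exists_fixedPoint'
    (hs.inter isClosed_closedBall).isComplete hball (x := 0) ⟨hzero, by simp⟩ (edist_ne_top _ _)
  exact ⟨y, hy.1, mem_closedBall_zero_iff.1 hy.2, hfixed⟩

variable (𝕜) in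
theorem exists_one_sub_mul_one_sub_eq [StarRing A] [ContinuousStar A] [StarModule 𝕜 A] {b : A}
    (hb : ‖b‖ < 1) (hsa : IsSelfAdjoint b) :
    ∃ y : A, (1 - y) * (1 - y) = 1 - b ∧ ‖y‖ < 1 ∧ IsSelfAdjoint y ∧
      ∀ c, Commute c b → Commute c y := by
  let s : Set A := {x | star x = x} ∩ ⋂ c ∈ {c | Commute c b}, {x | c * x = x * c}
  have hs : IsClosed s := (isClosed_eq continuous_star continuous_id).inter <|
    isClosed_biInter fun c _ ↦ isClosed_eq (continuous_const_mul c) (continuous_mul_const c)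
  have mem_s {x : A} : x ∈ s ↔ IsSelfAdjoint x ∧ ∀ c, Commute c b → Commute c x := by
    simp [s, IsSelfAdjoint, Commute, SemiconjBy]
  have hmaps : Set.MapsTo (visserMap 𝕜 b) s s := by
    intro x hx
    obtain ⟨hx, hcomm⟩ := mem_s.1 hx
    refine mem_s.2 ⟨?_, fun c hc ↦ ?_⟩
    · simp [visserMap, IsSelfAdjoint, hx.star_eq, hsa.star_eq]
    · exact (hc.add_right ((hcomm c hc).mul_right (hcomm c hc))).smul_right _
  obtain ⟨y, hy, hnorm, hfixed⟩ := exists_mem_isFixedPt_visserMap (𝕜 := 𝕜) hb hs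
    (mem_s.2 ⟨.zero A, fun c _ ↦ Commute.zero_right c⟩) hmaps
  exact ⟨y, one_sub_mul_one_sub_of_isFixedPt_visserMap hfixed, hnorm.trans_lt hb, mem_s.1 hy⟩

end SquareRoot

section Symmetries

variable {A : Type*}

theorem add_mul_add_self_of_mul_self_eq_one [Ring A] {u v : A} (huu : u * u = 1)
    (hvv : v * v = 1) : (u + v) * (u + v) = 4 - (u - v) * (u - v) := by
  calc (u + v) * (u + v) = 2 * (u * u) + 2 * (v * v) - (u - v) * (u - v) := by noncomm_ring
    _ = 4 - (u - v) * (u - v) := by rw [huu, hvv]; norm_num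

theorem commute_sub_mul_sub [Ring A] {u v : A} (huu : u * u = 1) (hvv : v * v = 1) :
    Commute u ((u - v) * (u - v)) := by
  rw [commute_iff_eq]
  calc u * ((u - v) * (u - v)) = u * (v * v) + u * (u * u) - u * u * v - u * v * u := by
        noncomm_ring
    _ = v * v * u + u * u * u - v * (u * u) - u * v * u := by simp only [huu, hvv]; noncomm_ring
    _ = (u - v) * (u - v) * u := by noncomm_ring

variable [NormedRing A] [CompleteSpace A] [StarRing A] [ContinuousStar A] (𝕜 : Type*) [RCLike 𝕜]
  [NormedAlgebra 𝕜 A] [StarModule 𝕜 A]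

include 𝕜 in
theorem exists_mul_self_eq_add_mul_add {u v : A} (hu : IsSelfAdjoint u) (hv : IsSelfAdjoint v)
    (huu : u * u = 1) (hvv : v * v = 1) (h : ‖u - v‖ < 2) :
    ∃ r : A, r * r = (u + v) * (u + v) ∧ IsSelfAdjoint r ∧ Commute u r ∧ Commute v r ∧
      IsUnit r ∧ IsUnit (2 + r) := by
  have hnorm : ‖(4⁻¹ : 𝕜) • ((u - v) * (u - v))‖ < 1 := by
    rw [norm_smul, norm_inv, RCLike.norm_ofNat]
    nlinarith [norm_mul_le (u - v) (u - v), norm_nonneg (u - v)]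
  have hsa : IsSelfAdjoint ((4⁻¹ : 𝕜) • ((u - v) * (u - v))) :=
    (IsSelfAdjoint.ofNat 4).inv₀.smul (((hu.sub hv).commute_iff (hu.sub hv)).1 (.refl _))
  obtain ⟨y, hsq, hy, hysa, hcomm⟩ := exists_one_sub_mul_one_sub_eq 𝕜 hnorm hsa
  have hyu : Commute u y := hcomm u ((commute_sub_mul_sub huu hvv).smul_right _)
  have hyv : Commute v y := by
    refine hcomm v (Commute.smul_right ?_ _)
    rw [← neg_mul_neg, neg_sub]
    exact commute_sub_mul_sub hvv huu
  have htwo : IsSelfAdjoint (2 : 𝕜) := .ofNat 2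
  refine ⟨(2 : 𝕜) • (1 - y), ?_, htwo.smul ((IsSelfAdjoint.one A).sub hysa),
    ((Commute.one_right u).sub_right hyu).smul_right _,
    ((Commute.one_right v).sub_right hyv).smul_right _, ?_, ?_⟩
  · calc (2 : 𝕜) • (1 - y) * (2 : 𝕜) • (1 - y) = (4 : 𝕜) • 1 - (u - v) * (u - v) := by
          rw [smul_mul_smul_comm, hsq]
          module
      _ = (u + v) * (u + v) := by
          rw [add_mul_add_self_of_mul_self_eq_one huu hvv, Algebra.smul_def, map_ofNat, mul_one]
  · exact (isUnit_one_sub_of_norm_lt_one hy).smul (Units.mk0 (2 : 𝕜) two_ne_zero)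
  · have hhalf : IsUnit (1 - (2⁻¹ : 𝕜) • y) := by
      refine isUnit_one_sub_of_norm_lt_one ?_
      rw [norm_smul, norm_inv, RCLike.norm_ofNat]
      linarith
    have hsum : 2 + (2 : 𝕜) • (1 - y) = (4 : 𝕜) • (1 - (2⁻¹ : 𝕜) • y) := by
      have htwo_smul : (2 : A) = (2 : 𝕜) • 1 := by rw [Algebra.smul_def, map_ofNat, mul_one]
      rw [htwo_smul]
      module
    rw [hsum]
    exact hhalf.smul (Units.mk0 (4 : 𝕜) (OfNat.ofNat_ne_zero 4))

include 𝕜 in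
theorem exists_symmetry_mul_eq_mul {u v : A} (hu : IsSelfAdjoint u) (hv : IsSelfAdjoint v)
    (huu : u * u = 1) (hvv : v * v = 1) (h : ‖u - v‖ < 2) :
    ∃ w : A, IsSelfAdjoint w ∧ w * w = 1 ∧ w * u = v * w ∧ IsUnit (u + w) := by
  obtain ⟨_, hsq, hsa, hur, hvr, ⟨r, rfl⟩, hunit⟩ :=
    exists_mul_self_eq_add_mul_add 𝕜 hu hv huu hvv h
  have hru : Commute u ↑r⁻¹ := hur.units_inv_right
  have hrv : Commute v ↑r⁻¹ := hvr.units_inv_right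
  have hsum : Commute (u + v) ↑r⁻¹ := hru.add_left hrv
  have hrsa : IsSelfAdjoint (↑r⁻¹ : A) := by
    have hstar : star r = r := Units.ext hsa
    rw [IsSelfAdjoint, ← Units.coe_star, star_inv, hstar]
  have hinter : (u + v) * u = v * (u + v) := by rw [add_mul, mul_add, huu, hvv, add_comm]
  have hww : (u + v) * ↑r⁻¹ * ((u + v) * ↑r⁻¹) = 1 := by
    rw [hsum.symm.mul_mul_mul_comm, ← hsq, mul_assoc, Units.mul_inv_cancel_left, Units.mul_inv]
  refine ⟨(u + v) * ↑r⁻¹, ((hu.add hv).commute_iff hrsa).1 hsum, hww, ?_, ?_⟩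
  · rw [mul_assoc, ← hru.eq, ← mul_assoc, hinter, mul_assoc]
  · have hsquare : (u + (u + v) * ↑r⁻¹) * (u + (u + v) * ↑r⁻¹) = 2 + r := by
      calc (u + (u + v) * ↑r⁻¹) * (u + (u + v) * ↑r⁻¹)
          = u * u + (u * (u + v) * ↑r⁻¹ + (u + v) * (↑r⁻¹ * u)) + 1 := by rw [← hww]; noncomm_ring
        _ = 2 + (u * (u + v) + (u + v) * u) * ↑r⁻¹ := by
            rw [← hru.eq, huu, add_mul _ _ (↑r⁻¹ : A), ← mul_assoc, ← one_add_one_eq_two]; abel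
        _ = 2 + (u + v) * (u + v) * ↑r⁻¹ := by
            rw [hinter, ← add_mul]
        _ = 2 + r := by rw [← hsq, mul_assoc, Units.mul_inv, mul_one]
    exact isUnit_mul_self_iff.1 (hsquare ▸ hunit)

end Symmetries

section Reflections

variable {𝕜 E F : Type*} [RCLike 𝕜] [NormedAddCommGroup E] [InnerProductSpace 𝕜 E]
  [NormedAddCommGroup F] [InnerProductSpace 𝕜 F]

theorem bijective_adjoint [CompleteSpace E] [CompleteSpace F] {T : E →L[𝕜] F}
    (hT : Bijective T) : Bijective (adjoint T) := by
  obtain ⟨e, rfl⟩ : ∃ e : E ≃L[𝕜] F, (e : E →L[𝕜] F) = T :=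
    ⟨.ofBijective T (LinearMap.ker_eq_bot.2 hT.1) (LinearMap.range_eq_top.2 hT.2), rfl⟩
  refine bijective_iff_has_inverse.2 ⟨adjoint (e.symm : F →L[𝕜] E), fun y ↦ ?_, fun x ↦ ?_⟩
  · rw [← ContinuousLinearMap.comp_apply, ← adjoint_comp, e.coe_comp_coe_symm, adjoint_id, id_apply]
  · rw [← ContinuousLinearMap.comp_apply, ← adjoint_comp, e.coe_symm_comp_coe, adjoint_id, id_apply]

theorem bijective_orthogonalProjectionOnto_comp_subtypeL_iff (M N : Submodule 𝕜 E)
    [M.HasOrthogonalProjection] :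
    Bijective (M.orthogonalProjectionOnto ∘L N.subtypeL) ↔ IsCompl N Mᗮ := by
  have hker : M.orthogonalProjectionOnto.toLinearMap.ker = Mᗮ := ker_orthogonalProjectionOnto
  have hrange : Surjective M.orthogonalProjectionOnto.toLinearMap :=
    fun x ↦ ⟨x, orthogonalProjectionOnto_mem_subspace_eq_self x⟩
  rw [isCompl_iff, ← hker, ← LinearMap.injective_domRestrict_iff,
    ← LinearMap.surjective_domRestrict_iff hrange]
  rfl

theorem isCompl_orthogonal_comm [CompleteSpace E] (M N : Submodule 𝕜 E) [CompleteSpace M]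
    [CompleteSpace N] : IsCompl N Mᗮ ↔ IsCompl M Nᗮ := by
  suffices ∀ (M N : Submodule 𝕜 E) [CompleteSpace M] [CompleteSpace N],
      IsCompl N Mᗮ → IsCompl M Nᗮ from ⟨this M N, this N M⟩
  intro M N _ _ h
  have hbij := bijective_adjoint ((bijective_orthogonalProjectionOnto_comp_subtypeL_iff M N).2 h)
  rw [adjoint_comp, adjoint_subtypeL, adjoint_orthogonalProjectionOnto] at hbij
  exact (bijective_orthogonalProjectionOnto_comp_subtypeL_iff N M).1 hbij

theorem norm_sub_lt_two_of_antilipschitzWith_add {u v : E →L[𝕜] F}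
    (hu : ∀ x, ‖u x‖ = ‖x‖) (hv : ∀ x, ‖v x‖ = ‖x‖)
    {K : ℝ≥0} (h : AntilipschitzWith K (u + v)) : ‖u - v‖ < 2 := by
  set k : ℝ := K + 1
  have hk : 0 < k := by positivity
  have hlower (x : E) : k⁻¹ * ‖x‖ ≤ ‖u x + v x‖ := by
    rw [inv_mul_le_iff₀ hk]
    refine (h.le_mul_norm (map_zero _) x).trans ?_
    rw [add_apply]
    gcongr
    exact le_add_of_nonneg_right zero_le_one
  have hsq (x : E) : ‖(u - v) x‖ ^ 2 ≤ (4 - k⁻¹ ^ 2) * ‖x‖ ^ 2 := by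
    have hparallelogram := parallelogram_law_with_norm 𝕜 (u x) (v x)
    rw [hu, hv] at hparallelogram
    have := pow_le_pow_left₀ (by positivity) (hlower x) 2
    rw [sub_apply]
    linarith
  have hbound : ‖u - v‖ ≤ √(4 - k⁻¹ ^ 2) := by
    refine opNorm_le_bound _ (Real.sqrt_nonneg _) fun x ↦ ?_
    rw [← Real.sqrt_sq (norm_nonneg x), ← Real.sqrt_mul' _ (sq_nonneg _)]
    exact Real.le_sqrt_of_sq_le (hsq x)
  refine hbound.trans_lt ((Real.sqrt_lt' two_pos).2 ?_)
  have : 0 < k⁻¹ ^ 2 := by positivity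
  linarith

variable (M N : Submodule 𝕜 E) [M.HasOrthogonalProjection] [N.HasOrthogonalProjection]

theorem reflection_eq_neg_iff (x : E) : M.reflection x = -x ↔ x ∈ Mᗮ := by
  rw [← reflection_eq_self_iff, reflection_orthogonal_apply, neg_eq_iff_eq_neg]

theorem self_add_reflection_mem (x : E) : x + M.reflection x ∈ M := by
  rw [reflection_apply, add_sub_cancel]
  exact nsmul_mem (starProjection_apply_mem M x) 2

theorem self_sub_reflection_mem_orthogonal (x : E) : x - M.reflection x ∈ Mᗮ := by
  simpa [reflection_orthogonal_apply, sub_eq_add_neg] using self_add_reflection_mem Mᗮ x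

theorem isCompl_orthogonal_of_bijective_reflection_add_reflection
    (h : Bijective (M.reflection + N.reflection : E →L[𝕜] E)) : IsCompl N Mᗮ := by
  refine ⟨disjoint_def.2 fun x hxN hxM ↦ h.1 ?_, codisjoint_iff.2 (eq_top_iff'.2 fun y ↦ ?_)⟩
  · simp [reflection_mem_subspace_orthogonalComplement_eq_neg hxM,
      reflection_mem_subspace_eq_self hxN]
  · obtain ⟨z, rfl⟩ := h.2 y
    refine mem_sup.2 ⟨_, self_add_reflection_mem N z, _,
      neg_mem (self_sub_reflection_mem_orthogonal M z), ?_⟩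
    simp only [neg_sub, add_apply, ContinuousLinearEquiv.coe_coe,
      LinearIsometryEquiv.coe_toContinuousLinearEquiv]
    abel

variable {M N} in
theorem bijective_reflection_add_reflection_of_isCompl (hNM : IsCompl N Mᗮ) (hMN : IsCompl M Nᗮ) :
    Bijective (M.reflection + N.reflection : E →L[𝕜] E) := by
  constructor
  · refine (injective_iff_map_eq_zero _).2 fun x hx ↦ ?_
    have hsum : M.reflection x + N.reflection x = 0 := hx
    have heq : x + M.reflection x = x - N.reflection x := by
      rw [sub_eq_add_neg, eq_neg_of_add_eq_zero_left hsum]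
    have hM : x + M.reflection x = 0 := disjoint_def.1 hMN.disjoint _
      (self_add_reflection_mem M x) (heq ▸ self_sub_reflection_mem_orthogonal N x)
    have hxM : x ∈ Mᗮ := (reflection_eq_neg_iff M x).1 (eq_neg_of_add_eq_zero_right hM)
    have hxN : x ∈ N := (N.reflection_eq_self_iff x).1 (sub_eq_zero.1 (heq ▸ hM)).symm
    exact disjoint_def.1 hNM.disjoint x hxN hxM
  · intro y
    obtain ⟨n, hn, a, ha, hna⟩ := mem_sup.1 (hNM.sup_eq_top ▸ mem_top (x := y))
    obtain ⟨m, hm, b, hb, hmb⟩ := mem_sup.1 (hMN.sup_eq_top ▸ mem_top (x := y))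
    have hnb : n - b = m - a := by rw [sub_eq_sub_iff_add_eq_add, hna, hmb]
    refine ⟨(2⁻¹ : 𝕜) • (n - b), ?_⟩
    have hM : M.reflection (n - b) = m + a := by
      rw [hnb, map_sub, reflection_mem_subspace_eq_self hm,
        reflection_mem_subspace_orthogonalComplement_eq_neg ha, sub_neg_eq_add]
    have hN : N.reflection (n - b) = n + b := by
      rw [map_sub, reflection_mem_subspace_eq_self hn,
        reflection_mem_subspace_orthogonalComplement_eq_neg hb, sub_neg_eq_add]
    rw [map_smul, inv_smul_eq_iff₀ two_ne_zero, two_smul]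
    calc M.reflection (n - b) + N.reflection (n - b) = (m + b) + (n + a) := by rw [hM, hN]; abel
      _ = y + y := by rw [hmb, hna]

theorem isUnit_reflection_add_reflection_iff (M N : Submodule 𝕜 E) [CompleteSpace E]
    [CompleteSpace M] [CompleteSpace N] :
    IsUnit (M.reflection + N.reflection : E →L[𝕜] E) ↔ IsCompl N Mᗮ := by
  rw [isUnit_iff_bijective]
  exact ⟨isCompl_orthogonal_of_bijective_reflection_add_reflection M N, fun h ↦
    bijective_reflection_add_reflection_of_isCompl h ((isCompl_orthogonal_comm M N).1 h)⟩

theorem isSelfAdjoint_reflection [CompleteSpace E] :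
    IsSelfAdjoint (M.reflection : E →L[𝕜] E) := by
  have : (M.reflection : E →L[𝕜] E) = M.starProjection + M.starProjection - 1 := by
    ext x
    simp [reflection_apply, two_smul]
  rw [this]
  exact (((isSelfAdjoint_starProjection M).add (isSelfAdjoint_starProjection M))).sub (.one _)

theorem reflection_mul_reflection_self : (M.reflection : E →L[𝕜] E) * M.reflection = 1 := by
  ext x
  exact M.reflection_reflection x

theorem exists_reflection_eq [CompleteSpace E] {w : E →L[𝕜] E} (hsa : IsSelfAdjoint w)
    (hww : w * w = 1) :
    ∃ (L : Submodule 𝕜 E) (_ : CompleteSpace L), (L.reflection : E →L[𝕜] E) = w := by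
  have hproj : IsStarProjection ((2⁻¹ : 𝕜) • (1 + w)) := by
    refine ⟨?_, (IsSelfAdjoint.ofNat 2).inv₀.smul ((IsSelfAdjoint.one _).add hsa)⟩
    rw [IsIdempotentElem, smul_mul_smul_comm, add_mul, mul_add, mul_add, hww, one_mul, mul_one,
      one_mul]
    module
  obtain ⟨L, _, hL⟩ := isStarProjection_iff_eq_starProjection.1 hproj
  have : CompleteSpace L := L.orthogonal_orthogonal ▸ inferInstanceAs (CompleteSpace Lᗮᗮ)
  refine ⟨L, this, ?_⟩
  ext x
  have hx : (2⁻¹ : 𝕜) • (x + w x) = L.starProjection x := congr($hL x)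
  calc L.reflection x = 2 • (2⁻¹ : 𝕜) • (x + w x) - x := by rw [hx, reflection_apply]
    _ = w x := by module

theorem exists_bisector [CompleteSpace E] {M N : Submodule 𝕜 E} [CompleteSpace M]
    [CompleteSpace N] (h : IsCompl N Mᗮ) : ∃ (L : Submodule 𝕜 E) (_ : CompleteSpace L),
      (M.map (L.reflection.toLinearEquiv : E →ₗ[𝕜] E) = N) ∧ IsCompl M Lᗮ := by
  have hbij := isUnit_iff_bijective.1 ((isUnit_reflection_add_reflection_iff M N).2 h)
  obtain ⟨-, K, hK⟩ := (bijective_iff_dense_range_and_antilipschitz _).1 hbij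
  have hnorm : ‖(M.reflection : E →L[𝕜] E) - N.reflection‖ < 2 :=
    norm_sub_lt_two_of_antilipschitzWith_add M.reflection.norm_map N.reflection.norm_map hK
  obtain ⟨w, hsa, hww, hinter, hunit⟩ := exists_symmetry_mul_eq_mul 𝕜
    (isSelfAdjoint_reflection M) (isSelfAdjoint_reflection N) (reflection_mul_reflection_self M)
    (reflection_mul_reflection_self N) hnorm
  obtain ⟨L, _, rfl⟩ := exists_reflection_eq hsa hww
  rw [add_comm, isUnit_reflection_add_reflection_iff] at hunit
  refine ⟨L, ‹_›, ?_, hunit⟩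
  ext x
  have hx : L.reflection (M.reflection (L.reflection x)) = N.reflection x := by
    have := congr($hinter (L.reflection x))
    simpa using this
  rw [mem_map_equiv, ← reflection_eq_self_iff, ← N.reflection_eq_self_iff, ← hx,
    L.reflection_involutive.eq_iff]
  exact Iff.rfl

end Reflections

section Graphs

variable {𝕜 E F : Type*} [RCLike 𝕜] [NormedAddCommGroup E] [InnerProductSpace 𝕜 E]
  [NormedAddCommGroup F] [InnerProductSpace 𝕜 F]

theorem mem_Gr {T : E →L[𝕜] F} {z : WithLp 2 (E × F)} : z ∈ Gr T ↔ T z.fst = z.snd :=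
  eq_comm

variable (𝕜 E F) in
theorem firstSummand_eq_Gr_zero : firstSummand 𝕜 E F = Gr 0 := by
  ext z
  simp [firstSummand, Gr]

theorem eq_zero_of_mem_Gr_of_fst_eq_zero {T : E →L[𝕜] F} {z : WithLp 2 (E × F)} (hz : z ∈ Gr T)
    (hfst : z.fst = 0) : z = 0 :=
  WithLp.ofLp_injective 2 (Prod.ext hfst ((mem_Gr.1 hz).symm.trans (by rw [hfst, map_zero]; rfl)))

theorem disjoint_Gr_Gr_iff (S T : E →L[𝕜] F) : Disjoint (Gr S) (Gr T) ↔ Injective (T - S) := by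
  rw [disjoint_def, injective_iff_map_eq_zero]
  constructor
  · intro h x hx
    have hmem : WithLp.toLp 2 (x, T x) ∈ Gr S := mem_Gr.2 (sub_eq_zero.1 hx).symm
    exact congr(($(h _ hmem (mem_Gr.2 rfl))).fst)
  · intro h z hS hT
    refine eq_zero_of_mem_Gr_of_fst_eq_zero hS (h _ ?_)
    rw [sub_apply, mem_Gr.1 hS, mem_Gr.1 hT, sub_self]

theorem Gr_neg_inf_Gr_eq_bot_iff (T : E →L[𝕜] F) : Gr (-T) ⊓ Gr T = ⊥ ↔ Injective T := by
  rw [← disjoint_iff, disjoint_Gr_Gr_iff, sub_neg_eq_add, ← two_smul 𝕜 T]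
  exact (smul_right_injective F (two_ne_zero : (2 : 𝕜) ≠ 0)).of_comp_iff T

variable [CompleteSpace E] [CompleteSpace F]

theorem mem_Gr_orthogonal {T : E →L[𝕜] F} {z : WithLp 2 (E × F)} :
    z ∈ (Gr T)ᗮ ↔ z.fst + adjoint T z.snd = 0 := by
  have hinner (x : E) : inner 𝕜 (WithLp.toLp 2 (x, T x)) z =
      inner 𝕜 x (z.fst + adjoint T z.snd) := by
    rw [WithLp.prod_inner_apply, inner_add_right, adjoint_inner_right]
    rfl
  rw [mem_orthogonal]
  refine ⟨fun h ↦ ext_inner_left 𝕜 fun x ↦ ?_, fun h w hw ↦ ?_⟩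
  · rw [← hinner, h _ (mem_Gr.2 rfl), inner_zero_right]
  · have hw' : w = .toLp 2 (w.fst, T w.fst) := by rw [mem_Gr.1 hw]; rfl
    rw [hw', hinner, h, inner_zero_right]

theorem disjoint_Gr_orthogonal_iff (S T : E →L[𝕜] F) :
    Disjoint (Gr S) (Gr T)ᗮ ↔ Injective (.id 𝕜 E + adjoint T ∘L S : E →L[𝕜] E) := by
  rw [disjoint_def, injective_iff_map_eq_zero]
  constructor
  · intro h x hx
    have hmem : WithLp.toLp 2 (x, S x) ∈ (Gr T)ᗮ := mem_Gr_orthogonal.2 hx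
    exact congr(($(h _ (mem_Gr.2 rfl) hmem)).fst)
  · intro h z hS hT
    refine eq_zero_of_mem_Gr_of_fst_eq_zero hS (h _ ?_)
    rw [← mem_Gr_orthogonal.1 hT, ← mem_Gr.1 hS]
    rfl

theorem codisjoint_Gr_orthogonal_iff (S T : E →L[𝕜] F) :
    Codisjoint (Gr S) (Gr T)ᗮ ↔ Surjective (.id 𝕜 F + S ∘L adjoint T : F →L[𝕜] F) := by
  rw [codisjoint_iff, eq_top_iff']
  constructor
  · intro h y
    obtain ⟨a, ha, b, hb, hab⟩ := mem_sup.1 (h (.toLp 2 (0, y)))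
    refine ⟨b.snd, ?_⟩
    have hfst : a.fst + b.fst = 0 := congr(($hab).fst)
    have hsnd : a.snd + b.snd = y := congr(($hab).snd)
    have hadj : adjoint T b.snd = a.fst :=
      add_left_cancel ((mem_Gr_orthogonal.1 hb).trans ((add_comm _ _).trans hfst).symm)
    rw [← hsnd, ← mem_Gr.1 ha, ← hadj, add_comm (S _)]
    rfl
  · intro h z
    obtain ⟨y, hy⟩ := h (z.snd - S z.fst)
    have hy' : y + S (adjoint T y) = z.snd - S z.fst := hy
    refine mem_sup.2 ⟨.toLp 2 (z.fst + adjoint T y, S (z.fst + adjoint T y)), mem_Gr.2 rfl,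
      .toLp 2 (-adjoint T y, y), mem_Gr_orthogonal.2 (neg_add_cancel _), ?_⟩
    refine WithLp.ofLp_injective 2 (Prod.ext (add_neg_cancel_right _ _) ?_)
    change S (z.fst + adjoint T y) + y = z.snd
    rw [map_add, add_assoc, add_comm (S _) y, hy', add_sub_cancel]

theorem isCompl_Gr_Gr_zero_orthogonal (S : E →L[𝕜] F) :
    IsCompl (Gr S) (Gr (0 : E →L[𝕜] F))ᗮ := by
  rw [isCompl_iff, disjoint_Gr_orthogonal_iff, codisjoint_Gr_orthogonal_iff, map_zero, zero_comp,
    comp_zero, add_zero, add_zero]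
  exact ⟨injective_id, surjective_id⟩

theorem isCompl_Gr_Gr_neg_orthogonal_iff (T : E →L[𝕜] F) :
    IsCompl (Gr T) (Gr (-T))ᗮ ↔ Injective (.id 𝕜 E - adjoint T ∘L T : E →L[𝕜] E) ∧
      Surjective (.id 𝕜 F - T ∘L adjoint T : F →L[𝕜] F) := by
  rw [isCompl_iff, disjoint_Gr_orthogonal_iff, codisjoint_Gr_orthogonal_iff, map_neg, neg_comp,
    comp_neg, ← sub_eq_add_neg, ← sub_eq_add_neg]

end Graphs

section Decomposition

variable {𝕜 E : Type*} [RCLike 𝕜] [NormedAddCommGroup E] [InnerProductSpace 𝕜 E]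
  {L M : Submodule 𝕜 E} [L.HasOrthogonalProjection]

theorem map_orthogonalDecomposition_eq_Gr_iff {T : L →L[𝕜] Lᗮ} :
    M.map (L.orthogonalDecomposition.toLinearEquiv : E →ₗ[𝕜] WithLp 2 (L × Lᗮ)) = Gr T ↔
      ∀ x, x ∈ M ↔ T (L.orthogonalProjectionOnto x) = Lᗮ.orthogonalProjectionOnto x := by
  have hmem (x : E) : L.orthogonalDecomposition x ∈ Gr T ↔
      T (L.orthogonalProjectionOnto x) = Lᗮ.orthogonalProjectionOnto x := by
    rw [mem_Gr, fst_orthogonalDecomposition_apply, snd_orthogonalDecomposition_apply]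
  have hmap (x : E) := L.orthogonalDecomposition.injective.mem_set_image (s := (M : Set E)) (a := x)
  constructor
  · intro h x
    rw [← hmem, ← h]
    exact (hmap x).symm
  · intro h
    ext z
    obtain ⟨x, rfl⟩ := L.orthogonalDecomposition.surjective z
    rw [hmem, ← h]
    exact hmap x

variable (L) in
theorem map_orthogonalDecomposition_self :
    L.map (L.orthogonalDecomposition.toLinearEquiv : E →ₗ[𝕜] WithLp 2 (L × Lᗮ)) = Gr 0 := by
  refine map_orthogonalDecomposition_eq_Gr_iff.2 fun x ↦ ?_
  rw [zero_apply, eq_comm, orthogonalProjectionOnto_eq_zero_iff, orthogonal_orthogonal]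

theorem map_reflection_orthogonalDecomposition {T : L →L[𝕜] Lᗮ}
    (h : M.map (L.orthogonalDecomposition.toLinearEquiv : E →ₗ[𝕜] WithLp 2 (L × Lᗮ)) = Gr T) :
    (M.map (L.reflection.toLinearEquiv : E →ₗ[𝕜] E)).map
      (L.orthogonalDecomposition.toLinearEquiv : E →ₗ[𝕜] WithLp 2 (L × Lᗮ)) = Gr (-T) := by
  rw [map_orthogonalDecomposition_eq_Gr_iff] at h ⊢
  intro x
  rw [mem_map_equiv]
  change L.reflection x ∈ M ↔ _
  have hL : L.orthogonalProjectionOnto (L.reflection x) = L.orthogonalProjectionOnto x := by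
    refine (sub_eq_zero.1 ?_).symm
    rw [← map_sub, orthogonalProjectionOnto_eq_zero_iff]
    exact self_sub_reflection_mem_orthogonal L x
  have hLperp : Lᗮ.orthogonalProjectionOnto (L.reflection x) =
      -Lᗮ.orthogonalProjectionOnto x := by
    refine eq_neg_of_add_eq_zero_right ?_
    rw [← map_add, orthogonalProjectionOnto_eq_zero_iff, orthogonal_orthogonal]
    exact self_add_reflection_mem L x
  rw [h, hL, hLperp, neg_apply, neg_eq_iff_eq_neg]

theorem exists_map_orthogonalDecomposition_eq_Gr {L M : Submodule 𝕜 E} [CompleteSpace L]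
    [CompleteSpace M] (h : IsCompl M Lᗮ) : ∃ T : L →L[𝕜] Lᗮ,
      M.map (L.orthogonalDecomposition.toLinearEquiv : E →ₗ[𝕜] WithLp 2 (L × Lᗮ)) = Gr T := by
  obtain ⟨hinj, hsurj⟩ := (bijective_orthogonalProjectionOnto_comp_subtypeL_iff L M).2 h
  let e : M ≃L[𝕜] L := .ofBijective (L.orthogonalProjectionOnto ∘L M.subtypeL)
    (LinearMap.ker_eq_bot.2 hinj) (LinearMap.range_eq_top.2 hsurj)
  refine ⟨Lᗮ.orthogonalProjectionOnto ∘L M.subtypeL ∘L (e.symm : L →L[𝕜] M),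
    map_orthogonalDecomposition_eq_Gr_iff.2 fun x ↦ ⟨fun hx ↦ ?_, fun hx ↦ ?_⟩⟩
  · have hm : e.symm (L.orthogonalProjectionOnto x) = ⟨x, hx⟩ := e.symm_apply_apply ⟨x, hx⟩
    exact congr(Lᗮ.orthogonalProjectionOnto $hm)
  · have hm : L.orthogonalProjectionOnto (e.symm (L.orthogonalProjectionOnto x) : E) =
        L.orthogonalProjectionOnto x := e.apply_symm_apply _
    have hxm : L.orthogonalDecomposition (e.symm (L.orthogonalProjectionOnto x) : E) =
        L.orthogonalDecomposition x := by
      rw [orthogonalDecomposition_apply, orthogonalDecomposition_apply, hm]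
      exact congr(WithLp.toLp 2 (_, $hx))
    exact L.orthogonalDecomposition.injective hxm ▸ coe_mem _

end Decomposition

section Models

universe u v

variable {𝕜 : Type u} [RCLike 𝕜] {X : Type v} [NormedAddCommGroup X] [InnerProductSpace 𝕜 X]
  {Y : Type*} [NormedAddCommGroup Y] [InnerProductSpace 𝕜 Y]

theorem isCompl_orthogonal_map_iff (U : X ≃ₗᵢ[𝕜] Y) (M N : Submodule 𝕜 X) :
    IsCompl (N.map (U.toLinearEquiv : X →ₗ[𝕜] Y)) (M.map (U.toLinearEquiv : X →ₗ[𝕜] Y))ᗮ ↔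
      IsCompl N Mᗮ := by
  have hortho : (M.map (U.toLinearEquiv : X →ₗ[𝕜] Y))ᗮ =
      Mᗮ.map (U.toLinearEquiv : X →ₗ[𝕜] Y) := (map_orthogonal_equiv M U).symm
  rw [hortho, (orderIsoMapComap U.toLinearEquiv).isCompl_iff (x := N)]
  rfl

theorem UnitarilyEquivalentPairs.isCompl_orthogonal_iff [CompleteSpace X] {M N : Submodule 𝕜 X}
    {A B : Submodule 𝕜 Y} [CompleteSpace M] [CompleteSpace N]
    (h : UnitarilyEquivalentPairs M N A B) : IsCompl N Mᗮ ↔ IsCompl B Aᗮ := by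
  obtain ⟨U, ⟨rfl, rfl⟩ | ⟨rfl, rfl⟩⟩ := h
  · rw [isCompl_orthogonal_map_iff]
  · rw [isCompl_orthogonal_map_iff, isCompl_orthogonal_comm]

theorem UnitarilyEquivalentPairs.inf_eq_bot_iff {M N : Submodule 𝕜 X} {A B : Submodule 𝕜 Y}
    (h : UnitarilyEquivalentPairs M N A B) : M ⊓ N = ⊥ ↔ A ⊓ B = ⊥ := by
  have hmap (U : X ≃ₗᵢ[𝕜] Y) : M.map (U.toLinearEquiv : X →ₗ[𝕜] Y) ⊓
      N.map (U.toLinearEquiv : X →ₗ[𝕜] Y) = ⊥ ↔ M ⊓ N = ⊥ := by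
    rw [← Submodule.map_inf _ U.injective]
    exact map_eq_bot_iff (orderIsoMapComap U.toLinearEquiv)
  obtain ⟨U, ⟨rfl, rfl⟩ | ⟨rfl, rfl⟩⟩ := h
  · rw [hmap]
  · rw [inf_comm (Submodule.map _ N), hmap]

theorem hasInjectiveSymmetricGraphModel_iff (M N : Submodule 𝕜 X) :
    HasInjectiveSymmetricGraphModel M N ↔ HasSymmetricGraphModel M N ∧ M ⊓ N = ⊥ := by
  constructor
  · rintro ⟨X₁, X₂, _, _, _, _, _, _, T, hT, hinj, hsurj, hequiv⟩
    exact ⟨⟨X₁, X₂, _, _, ‹_›, _, _, ‹_›, T, hinj, hsurj, hequiv⟩,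
      hequiv.inf_eq_bot_iff.2 ((Gr_neg_inf_Gr_eq_bot_iff T).2 hT)⟩
  · rintro ⟨⟨X₁, X₂, _, _, _, _, _, _, T, hinj, hsurj, hequiv⟩, hinf⟩
    exact ⟨X₁, X₂, _, _, ‹_›, _, _, ‹_›, T,
      (Gr_neg_inf_Gr_eq_bot_iff T).1 (hequiv.inf_eq_bot_iff.1 hinf), hinj, hsurj, hequiv⟩

section Projections

variable {M N : Submodule 𝕜 X}

theorem isCommonComplement_orthogonal_iff [M.HasOrthogonalProjection] :
    IsCommonComplement Mᗮ M N ↔ IsCompl N Mᗮ :=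
  ⟨fun h ↦ h.2.2, fun h ↦ ⟨M.isClosed_orthogonal, M.isCompl_orthogonal, h⟩⟩

variable [CompleteSpace X] [CompleteSpace M] [CompleteSpace N]

theorem hasSymmetricGraphModel_iff : HasSymmetricGraphModel M N ↔ IsCompl N Mᗮ := by
  constructor
  · rintro ⟨X₁, X₂, _, _, _, _, _, _, T, hinj, hsurj, hequiv⟩
    exact hequiv.isCompl_orthogonal_iff.2 ((isCompl_Gr_Gr_neg_orthogonal_iff T).2 ⟨hinj, hsurj⟩)
  · intro h
    obtain ⟨L, _, hreflection, hML⟩ := exists_bisector h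
    obtain ⟨T, hT⟩ := exists_map_orthogonalDecomposition_eq_Gr hML
    have hequiv : UnitarilyEquivalentPairs M N (Gr (-T)) (Gr T) :=
      ⟨L.orthogonalDecomposition,
        .inr ⟨hT, hreflection ▸ map_reflection_orthogonalDecomposition hT⟩⟩
    obtain ⟨hinj, hsurj⟩ :=
      (isCompl_Gr_Gr_neg_orthogonal_iff T).1 (hequiv.isCompl_orthogonal_iff.1 h)
    exact ⟨L, Lᗮ, _, _, ‹_›, _, _, inferInstance, T, hinj, hsurj, hequiv⟩

theorem hasOneSidedGraphModel_iff : HasOneSidedGraphModel M N ↔ IsCompl N Mᗮ := by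
  constructor
  · rintro ⟨Y₁, Y₂, _, _, _, _, _, _, S, hequiv⟩
    rw [firstSummand_eq_Gr_zero] at hequiv
    exact hequiv.isCompl_orthogonal_iff.2 (isCompl_Gr_Gr_zero_orthogonal S)
  · intro h
    obtain ⟨S, hS⟩ := exists_map_orthogonalDecomposition_eq_Gr h
    refine ⟨M, Mᗮ, _, _, ‹_›, _, _, inferInstance, S, M.orthogonalDecomposition, .inl ⟨?_, hS⟩⟩
    rw [firstSummand_eq_Gr_zero, map_orthogonalDecomposition_self]

end Projections

theorem orthoDiff_inf_orthoDiff (M N : Submodule 𝕜 X) :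
    orthoDiff M (M ⊓ N) ⊓ orthoDiff N (M ⊓ N) = ⊥ := by
  rw [orthoDiff, orthoDiff, ← inf_inf_distrib_right, inf_orthogonal_eq_bot]

theorem isClosed_orthoDiff {M : Submodule 𝕜 X} (hM : IsClosed (M : Set X)) (D : Submodule 𝕜 X) :
    IsClosed (orthoDiff M D : Set X) :=
  hM.inter D.isClosed_orthogonal

theorem isOrtho_orthoDiff (M D : Submodule 𝕜 X) : orthoDiff M D ⟂ D :=
  isOrtho_iff_le.2 inf_le_right

theorem isCompl_orthoDiff_iff {M N D : Submodule 𝕜 X} [D.HasOrthogonalProjection]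
    (hM : D ≤ M) (hN : D ≤ N) : IsCompl (orthoDiff N D) (orthoDiff M D)ᗮ ↔ IsCompl N Mᗮ := by
  have hsup {K : Submodule 𝕜 X} (hK : D ≤ K) : orthoDiff K D ⊔ D = K := by
    rw [sup_comm, orthoDiff, inf_comm, sup_orthogonal_inf_of_hasOrthogonalProjection hK]
  have hortho : (orthoDiff M D)ᗮ = D ⊔ Mᗮ := by
    rw [← sup_orthogonal_inf_of_hasOrthogonalProjection (isOrtho_orthoDiff M D).symm.le,
      inf_orthogonal, sup_comm D (orthoDiff M D), hsup hM]
  have hND : Disjoint (orthoDiff N D) D := (isOrtho_orthoDiff N D).disjoint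
  have hDM : Disjoint D Mᗮ := M.orthogonal_disjoint.mono_left hM
  rw [hortho]
  constructor
  · intro h
    simpa only [hsup hN] using hDM.isCompl_sup_left_of_isCompl_sup_right h
  · intro h
    rw [← hsup hN] at h
    exact hND.isCompl_sup_right_of_isCompl_sup_left h

end Models

end CommonComplement

theorem corollary4p6 {𝕜 : Type*} [RCLike 𝕜] {X : Type*} [NormedAddCommGroup X]
    [InnerProductSpace 𝕜 X] [CompleteSpace X] (M N : Submodule 𝕜 X)
    (hM : IsClosed (M : Set X)) (hN : IsClosed (N : Set X)) :
    List.TFAE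
      [CommonComplement.IsCommonComplement Mᗮ M N,
       CommonComplement.HasSymmetricGraphModel M N,
       CommonComplement.HasInjectiveSymmetricGraphModel
         (CommonComplement.orthoDiff M (M ⊓ N)) (CommonComplement.orthoDiff N (M ⊓ N)),
       CommonComplement.HasOneSidedGraphModel M N] ∧
    (CommonComplement.HasInjectiveSymmetricGraphModel M N ↔
      CommonComplement.IsCommonComplement Mᗮ M N ∧ M ⊓ N = ⊥) := by
  have := hM.completeSpace_coe
  have := hN.completeSpace_coe
  have : CompleteSpace ↥(M ⊓ N) := (hM.inter hN).completeSpace_coe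
  have := (CommonComplement.isClosed_orthoDiff hM (M ⊓ N)).completeSpace_coe
  have := (CommonComplement.isClosed_orthoDiff hN (M ⊓ N)).completeSpace_coe
  rw [CommonComplement.hasInjectiveSymmetricGraphModel_iff,
    CommonComplement.hasInjectiveSymmetricGraphModel_iff,
    and_iff_left (CommonComplement.orthoDiff_inf_orthoDiff M N),
    CommonComplement.hasSymmetricGraphModel_iff, CommonComplement.hasSymmetricGraphModel_iff,
    CommonComplement.isCompl_orthoDiff_iff inf_le_left inf_le_right,
    CommonComplement.hasOneSidedGraphModel_iff, CommonComplement.isCommonComplement_orthogonal_iff]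
  exact ⟨by simp only [List.tfae_cons_self, List.tfae_singleton], Iff.rfl⟩
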